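/- Let $F:\mathbb R^n\to\mathbb R^n$ be $C^2$ with $F(0)=0$, and write $E(e,t)$ for the solution of $\dot e=F(e)$ that starts from $e$ at time $0$. For a matrix function $P$, let $$\mathfrak d_F P(e):=\lim_{h\to0}\frac{P(E(e,h))-P(e)}{h}.$$ Let $Q$ be a symmetric positive definite matrix with smallest eigenvalue $\mu_{\min}\{Q\}$. Suppose that there are a $C^2$ function $P$ with values in the symmetric $n\times n$ matrices, a non-increasing function $\underline p:[0,\infty)\to\mathbb R$ and a non-decreasing function $\overline p:[0,\infty)\to\mathbb R$ such that, for all $e\in\mathbb R^n$, $$0<\underline p(|e|)\,I\le P(e)\le\overline p(|e|)\,I,$$ $$\mathfrak d_F P(e)+P(e)\frac{\partial F}{\partial e}(e)+\frac{\partial F}{\partial e}(e)^\top P(e)\le -Q,$$ and that $\lim_{r\to+\infty}\underline p(r)\,r^2=+\infty$. Let $d_P(e_1,e_2)$ be the Riemannian distance of $P$, that is, the infimum of $$\int_{a}^{b}\sqrt{\gamma'(s)^\top P(\gamma(s))\,\gamma'(s)}\,ds$$ over all piecewise $C^1$ paths $\gamma:[a,b]\to\mathbb R^n$ from $e_1$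 to $e_2$, and let $V(e)=d_P(e,0)$. Then $V$ is a Lyapunov function for $\dot e=F(e)$. Precisely: 1. $V$ is continuous, $V(0)=0$, $V(e)>0$ for $e\neq0$, $V(e)\to+\infty$ as $|e|\to\infty$, and $\sqrt{\underline p(|e|)}\,|e|\le V(e)\le\sqrt{\overline p(|e|)}\,|e|$ for all $e$. 2. Every solution exists for all $t\ge0$. For every $e$ the upper Dini derivative $D^+_FV(e):=\limsup_{h\searrow0}\frac{V(E(e,h))-V(e)}{h}$ is finite, and $$D^+_FV(e)\le-\frac{\mu_{\min}\{Q\}}{2\,\overline p(|e|)}\,V(e).$$ 3. The origin is locally exponentially stable: there are $k,\lambda,r>0$ with $|E(e,t)|\le k\,e^{-\lambda t}|e|$ for all $|e|\le r$ and $t\ge0$. It is also globally attractive: $\lim_{t\to+\infty}|E(e,t)|=0$ for every $e$. -/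

import Mathlib

open Filter Topology Set
open scoped Matrix

noncomputable section

/-- The state space `ℝⁿ` with its Euclidean norm. -/
abbrev StateSpace (n : ℕ) : Type := EuclideanSpace ℝ (Fin n)

/-- The Jacobian matrix `∂F/∂e (e)`; entry `(i, j)` is `∂Fᵢ/∂eⱼ (e)`. -/
def jacobian {n : ℕ} (F : StateSpace n → StateSpace n) (e : StateSpace n) :
    Matrix (Fin n) (Fin n) ℝ :=
  Matrix.of fun i j => (fderiv ℝ F e (EuclideanSpace.single j 1)) i

/-- `x` is a solution, on `[0, ∞)`, of `ẋ = F(x)` with `x(0) = e`. -/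
def IsForwardSolution {n : ℕ} (F : StateSpace n → StateSpace n) (e : StateSpace n)
    (x : ℝ → StateSpace n) : Prop :=
  x 0 = e ∧ IsIntegralCurveOn x (fun _ => F) (Ici 0)

/-- The derivative of the matrix function `P` along the flow of `F` at `e` exists and equals `D`:
`D = lim_{h → 0} (P(E(e,h)) - P(e)) / h`, where `E(e, ·)` is the solution of `ẋ = F(x)` through
`e` at time `0`, which is needed only for small `|h|`. -/
def HasDerivAlongFlow {n : ℕ} (F : StateSpace n → StateSpace n)
    (P : StateSpace n → Matrix (Fin n) (Fin n) ℝ) (e : StateSpace n)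
    (D : Matrix (Fin n) (Fin n) ℝ) : Prop :=
  ∀ x : ℝ → StateSpace n, x 0 = e → IsIntegralCurveAt x (fun _ => F) 0 →
    Tendsto (fun h : ℝ => h⁻¹ • (P (x h) - P e)) (𝓝[≠] 0) (𝓝 D)

/-- `γ` is a piecewise `C¹` path on `[a, b]`: it is continuous there, and `[a, b]` splits into
finitely many closed intervals on each of which `γ` is `C¹` (up to the end points). -/
def IsPiecewiseC1 {n : ℕ} (γ : ℝ → StateSpace n) (a b : ℝ) : Prop :=
  ContinuousOn γ (Icc a b) ∧
    ∃ (m : ℕ) (t : ℕ → ℝ), Monotone t ∧ t 0 = a ∧ t m = b ∧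
      ∀ i < m, ContDiffOn ℝ 1 γ (Icc (t i) (t (i + 1)))

/-- The length of `γ` on `[a, b]` in the metric `P`:
`∫ₐᵇ √(γ'(s)ᵀ P(γ(s)) γ'(s)) ds`. -/
def riemannLength {n : ℕ} (P : StateSpace n → Matrix (Fin n) (Fin n) ℝ)
    (γ : ℝ → StateSpace n) (a b : ℝ) : ℝ :=
  ∫ s in a..b,
    Real.sqrt ((deriv γ s).ofLp ⬝ᵥ (P (γ s) *ᵥ (deriv γ s).ofLp))

/-- The Riemannian distance `d_P(e₁, e₂)`: the infimum of the lengths of the piecewise `C¹`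
paths from `e₁` to `e₂`. -/
def riemannDist {n : ℕ} (P : StateSpace n → Matrix (Fin n) (Fin n) ℝ)
    (e₁ e₂ : StateSpace n) : ℝ :=
  sInf {l : ℝ | ∃ (a b : ℝ) (γ : ℝ → StateSpace n), a ≤ b ∧ IsPiecewiseC1 γ a b ∧
    γ a = e₁ ∧ γ b = e₂ ∧ l = riemannLength P γ a b}

/-- The smallest eigenvalue `μ_min{Q}` of a symmetric matrix `Q`. -/
def minEigenvalue {n : ℕ} (Q : Matrix (Fin n) (Fin n) ℝ) : ℝ :=
  sInf {μ : ℝ | Module.End.HasEigenvalue (Matrix.toLin' Q) μ}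

/-- The upper Dini derivative `limsup_{h ↘ 0} (V(x(h)) - V(x(0))) / h` at time `0` of `V` along
the curve `x`, as an extended real number. -/
def upperDini {n : ℕ} (V : StateSpace n → ℝ) (x : ℝ → StateSpace n) : EReal :=
  limsup (fun h : ℝ => (((V (x h) - V (x 0)) / h : ℝ) : EReal)) (𝓝[>] 0)

/-- Local exponential stability of the origin for the family of solutions `E(e, t)`. -/
def LocallyExpStable {n : ℕ} (E : StateSpace n → ℝ → StateSpace n) : Prop :=
  ∃ k lam r : ℝ, 0 < k ∧ 0 < lam ∧ 0 < r ∧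
    ∀ e : StateSpace n, ‖e‖ ≤ r → ∀ t : ℝ, 0 ≤ t → ‖E e t‖ ≤ k * Real.exp (-lam * t) * ‖e‖

/-- Global attractivity of the origin for the family of solutions `E(e, t)`. -/
def GloballyAttractive {n : ℕ} (E : StateSpace n → ℝ → StateSpace n) : Prop :=
  ∀ e : StateSpace n, Tendsto (fun t : ℝ => ‖E e t‖) atTop (𝓝 0)

end

noncomputable section

open MeasureTheory

/-! The Euler map `x ↦ x + h F(x)` fixes the origin, so it carries a nearly shortest path from `e`
to `0` to a path from `e + h F(e)` to `0`. By the matrix inequality and compactness it lowers the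
squared speed at `(x, v)` by at least `h κ |v|²`, for any `κ < μ`, uniformly over a ball containing
all the paths in play (`quad_euler_le`). Its image is therefore shorter, which bounds `V(e + h
F(e))` (`riemannDist_euler_le`). Solutions differ from the Euler step by `o(h)` and `V` is locally
Lipschitz, so the Dini estimate follows on letting `κ → μ`.

The rate involves `p̄(|e|)` only, although the path may leave the ball of radius `|e|`. The reason
is that the square root is linearised with a slope fixed in advance (`sqrt_le_of_sq_sub`): the gain
becomes a multiple of the Euclidean length, which is at least `|e| ≥ V(e) / √p̄(|e|)`.

The lower bound on `V` (`le_riemannLength`) and `p̲(r) r² → ∞` make sublevel sets bounded. Comparing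
`V` with a decaying exponential then gives exponential bounds, uniform over initial points in a
ball, for curves required to solve the equation only inside a large ball (`exists_exp_bound`).
Applied to a cut-off field, these yield global existence; applied to true solutions, they yield both
stability claims. -/

/-- The quadratic form `v ↦ vᵀ M v` of a matrix on the Euclidean state space. -/
def quad {n : ℕ} (M : Matrix (Fin n) (Fin n) ℝ) (v : StateSpace n) : ℝ :=
  v.ofLp ⬝ᵥ (M *ᵥ v.ofLp)

theorem riemannLength_eq {n : ℕ} (P : StateSpace n → Matrix (Fin n) (Fin n) ℝ)
    (γ : ℝ → StateSpace n) (a b : ℝ) :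
    riemannLength P γ a b = ∫ s in a..b, √(quad (P (γ s)) (deriv γ s)) := rfl

theorem quad_eq_sum {n : ℕ} (M : Matrix (Fin n) (Fin n) ℝ) (v : StateSpace n) :
    quad M v = ∑ i, ∑ j, v i * M i j * v j := by
  simp [quad, dotProduct, Matrix.mulVec, Finset.mul_sum, mul_assoc]

theorem quad_smul {n : ℕ} (M : Matrix (Fin n) (Fin n) ℝ) (c : ℝ) (v : StateSpace n) :
    quad M (c • v) = c ^ 2 * quad M v := by
  simp only [quad_eq_sum, Finset.mul_sum]
  refine Finset.sum_congr rfl fun i _ => Finset.sum_congr rfl fun j _ => ?_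
  simp; ring

theorem continuous_quad {n : ℕ} {P : StateSpace n → Matrix (Fin n) (Fin n) ℝ}
    (hP : ∀ i j, Continuous fun e => P e i j) :
    Continuous (Function.uncurry fun x v => quad (P x) v) := by
  simp only [Function.uncurry_def, quad_eq_sum]
  have := fun i j => (hP i j).comp (continuous_fst (X := StateSpace n) (Y := StateSpace n))
  simp only [Function.comp_def] at this
  fun_prop

/-! ### Calculus along piecewise C¹ paths -/

namespace IsPiecewiseC1

variable {n : ℕ} {γ : ℝ → StateSpace n} {a b : ℝ}

theorem const (x : StateSpace n) (a : ℝ) : IsPiecewiseC1 (fun _ => x) a a :=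
  ⟨continuousOn_const, 0, fun _ => a, monotone_const, rfl, rfl, by simp⟩

theorem exists_countable_differentiableAt (h : IsPiecewiseC1 γ a b) :
    ∃ S : Set ℝ, S.Countable ∧ ∀ s ∈ Ioo a b \ S, DifferentiableAt ℝ γ s := by
  obtain ⟨-, m, t, -, ht0, htm, hC⟩ := h
  refine ⟨range t, countable_range t, fun s ⟨hs, hst⟩ => ?_⟩
  -- The first breakpoint beyond `s` and its predecessor bracket `s`, strictly because `s` is not a
  -- breakpoint.
  have hex : ∃ i, s < t i := ⟨m, htm ▸ hs.2⟩
  classical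
  obtain ⟨k, hk⟩ : ∃ k, Nat.find hex = k + 1 := by
    refine Nat.exists_eq_succ_of_ne_zero fun h0 => ?_
    have := Nat.find_spec hex
    rw [h0, ht0] at this
    exact this.not_gt hs.1
  have hlt : s < t (k + 1) := hk ▸ Nat.find_spec hex
  have hge : t k ≤ s := not_lt.1 (Nat.find_min hex (by omega))
  have hkm : k < m := by
    have : Nat.find hex ≤ m := Nat.find_min' hex (htm ▸ hs.2)
    omega
  have hne : t k ≠ s := fun h => hst ⟨k, h⟩
  exact ((hC k hkm).differentiableOn one_ne_zero).differentiableAt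
    (Icc_mem_nhds (lt_of_le_of_ne hge hne) hlt)

/-- On each piece the one-sided derivative is continuous up to the end points. It can differ from
`deriv γ` only at those two points, which are null. -/
theorem intervalIntegrable (h : IsPiecewiseC1 γ a b) {X : Type*} [NormedAddCommGroup X]
    {f : StateSpace n → StateSpace n → X} (hf : Continuous (Function.uncurry f)) :
    IntervalIntegrable (fun s => f (γ s) (deriv γ s)) volume a b := by
  obtain ⟨hc, m, t, ht, rfl, rfl, hC⟩ := h
  refine IntervalIntegrable.trans_iterate fun k hk => ?_
  rcases (ht k.le_succ).eq_or_lt with he | hlt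
  · rw [← Nat.succ_eq_add_one, ← he]
  have hd : ContinuousOn (derivWithin γ (Icc (t k) (t (k + 1)))) (Icc (t k) (t (k + 1))) :=
    (hC k hk).continuousOn_derivWithin (uniqueDiffOn_Icc hlt) le_rfl
  have hi : IntervalIntegrable (fun s => f (γ s) (derivWithin γ (Icc (t k) (t (k + 1))) s))
      volume (t k) (t (k + 1)) := by
    refine ContinuousOn.intervalIntegrable ?_
    rw [uIcc_of_le hlt.le]
    exact hf.comp_continuousOn ((hC k hk).continuousOn.prodMk hd)
  refine hi.congr_ae ?_
  rw [uIoc_of_le hlt.le, ← restrict_Ioo_eq_restrict_Ioc]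
  filter_upwards [ae_restrict_mem measurableSet_Ioo] with s hs
  rw [derivWithin_of_mem_nhds (Icc_mem_nhds hs.1 hs.2)]

theorem intervalIntegrable_sqrt_quad (h : IsPiecewiseC1 γ a b)
    {P : StateSpace n → Matrix (Fin n) (Fin n) ℝ} (hP : ∀ i j, Continuous fun e => P e i j) :
    IntervalIntegrable (fun s => √(quad (P (γ s)) (deriv γ s))) volume a b :=
  h.intervalIntegrable (f := fun x v => √(quad (P x) v))
    (Real.continuous_sqrt.comp (continuous_quad hP))

theorem intervalIntegrable_norm_deriv (h : IsPiecewiseC1 γ a b) :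
    IntervalIntegrable (fun s => ‖deriv γ s‖) volume a b :=
  h.intervalIntegrable (f := fun _ v => ‖v‖) (continuous_norm.comp continuous_snd)

theorem norm_sub_le (h : IsPiecewiseC1 γ a b) {c : ℝ} (hac : a ≤ c) (hcb : c ≤ b) :
    ‖γ b - γ c‖ ≤ ∫ s in c..b, ‖deriv γ s‖ := by
  obtain ⟨S, hS, hd⟩ := h.exists_countable_differentiableAt
  have hint : IntervalIntegrable (deriv γ) volume c b :=
    (h.intervalIntegrable (f := fun _ v => v) continuous_snd).mono_set
      (by rw [uIcc_of_le hcb, uIcc_of_le (hac.trans hcb)]; exact Icc_subset_Icc_left hac)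
  rw [← integral_eq_of_hasDerivAt_off_countable_of_le γ (deriv γ) hcb hS
    (h.1.mono (Icc_subset_Icc_left hac))
    (fun s hs => (hd s ⟨Ioo_subset_Ioo_left hac hs.1, hs.2⟩).hasDerivAt) hint]
  exact intervalIntegral.norm_integral_le_integral_norm hcb

theorem comp (h : IsPiecewiseC1 γ a b) {Φ : StateSpace n → StateSpace n}
    (hΦ : ContDiff ℝ 1 Φ) : IsPiecewiseC1 (fun s => Φ (γ s)) a b := by
  obtain ⟨hc, m, t, ht, h0, hm, hC⟩ := h
  exact ⟨hΦ.continuous.comp_continuousOn hc, m, t, ht, h0, hm,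
    fun i hi => hΦ.comp_contDiffOn (hC i hi)⟩

theorem ae_differentiableAt (h : IsPiecewiseC1 γ a b) :
    ∀ᵐ s, s ∈ Ioo a b → DifferentiableAt ℝ γ s := by
  obtain ⟨S, hS, hd⟩ := h.exists_countable_differentiableAt
  filter_upwards [hS.ae_notMem volume] with s hs hsab using hd s ⟨hsab, hs⟩

end IsPiecewiseC1

/-! ### Prepending a segment to a path -/

/-- The path that runs along the segment from `x` to `γ a` on `[a - 1, a]` and follows `γ`
afterwards. -/
def prependSegment {n : ℕ} (x : StateSpace n) (γ : ℝ → StateSpace n) (a : ℝ) :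
    ℝ → StateSpace n :=
  fun s => if s ≤ a then x + (s - (a - 1)) • (γ a - x) else γ s

section prependSegment

variable {n : ℕ} (x : StateSpace n) {γ : ℝ → StateSpace n} {a b : ℝ}

theorem prependSegment_of_le {s : ℝ} (hs : s ≤ a) :
    prependSegment x γ a s = x + (s - (a - 1)) • (γ a - x) := if_pos hs

theorem prependSegment_of_ge {s : ℝ} (hs : a ≤ s) : prependSegment x γ a s = γ s := by
  rcases hs.eq_or_lt with rfl | hs
  · simp [prependSegment]
  · exact if_neg hs.not_ge

theorem IsPiecewiseC1.prependSegment (h : IsPiecewiseC1 γ a b) (hab : a ≤ b) :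
    IsPiecewiseC1 (prependSegment x γ a) (a - 1) b := by
  obtain ⟨hc, m, t, ht, h0, hm, hC⟩ := h
  have hta : ∀ i, a ≤ t i := fun i => h0 ▸ ht (Nat.zero_le i)
  have hsmooth : ContDiff ℝ 1 fun s : ℝ => x + (s - (a - 1)) • (γ a - x) := by fun_prop
  have hleft : EqOn (_root_.prependSegment x γ a) (fun s => x + (s - (a - 1)) • (γ a - x))
      (Icc (a - 1) a) := fun s hs => prependSegment_of_le x hs.2
  have hright : ∀ c d, a ≤ c → EqOn (_root_.prependSegment x γ a) γ (Icc c d) :=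
    fun c d hc s hs => prependSegment_of_ge x (hc.trans hs.1)
  refine ⟨?_, m + 1, fun i => Nat.casesOn i (a - 1) t, ?_, rfl, hm, ?_⟩
  · rw [← Icc_union_Icc_eq_Icc (by linarith : a - 1 ≤ a) hab]
    exact (hsmooth.continuous.continuousOn.congr hleft).union_of_isClosed
      (hc.congr (hright a b le_rfl)) isClosed_Icc isClosed_Icc
  · refine monotone_nat_of_le_succ fun i => ?_
    cases i with
    | zero => exact (by linarith [hta 0] : a - 1 ≤ t 0)
    | succ i => exact ht i.le_succ
  · intro i hi
    cases i with
    | zero =>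
      change ContDiffOn ℝ 1 _ (Icc (a - 1) (t 0))
      rw [h0]
      exact hsmooth.contDiffOn.congr hleft
    | succ i => exact (hC i (by omega)).congr (hright _ _ (hta i))

theorem riemannLength_prependSegment_le {P : StateSpace n → Matrix (Fin n) (Fin n) ℝ}
    (hP : ∀ i j, Continuous fun e => P e i j) (h : IsPiecewiseC1 γ a b) (hab : a ≤ b)
    {M : ℝ} (hM : 0 ≤ M) (hquad : ∀ z ∈ segment ℝ x (γ a), ∀ v, quad (P z) v ≤ M * ‖v‖ ^ 2) :
    riemannLength P (prependSegment x γ a) (a - 1) b ≤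
      √M * ‖x - γ a‖ + riemannLength P γ a b := by
  have hint := (h.prependSegment x hab).intervalIntegrable_sqrt_quad hP
  have hle : a - 1 ≤ a := by linarith
  have hsub : ∀ c d, a - 1 ≤ c → c ≤ d → d ≤ b → uIcc c d ⊆ uIcc (a - 1) b := by
    intro c d h1 h2 h3
    rw [uIcc_of_le h2, uIcc_of_le (h1.trans (h2.trans h3))]
    exact Icc_subset_Icc h1 h3
  rw [riemannLength_eq, ← intervalIntegral.integral_add_adjacent_intervals
    (hint.mono_set (hsub (a - 1) a le_rfl hle hab)) (hint.mono_set (hsub a b hle hab le_rfl))]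
  refine add_le_add ?_ (le_of_eq ?_)
  · have hb : ∀ s ∈ Ioo (a - 1) a,
        √(quad (P (prependSegment x γ a s)) (deriv (prependSegment x γ a) s)) ≤
          √M * ‖x - γ a‖ := by
      intro s hs
      have hev : prependSegment x γ a =ᶠ[𝓝 s] fun s => x + (s - (a - 1)) • (γ a - x) := by
        filter_upwards [Iio_mem_nhds hs.2] with r hr using prependSegment_of_le x (le_of_lt hr)
      have hder : HasDerivAt (prependSegment x γ a) (γ a - x) s := by
        refine HasDerivAt.congr_of_eventuallyEq ?_ hev
        simpa using (((hasDerivAt_id s).sub_const (a - 1)).smul_const (γ a - x)).const_add x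
      rw [hder.deriv, prependSegment_of_le x hs.2.le, norm_sub_rev]
      have hmem : x + (s - (a - 1)) • (γ a - x) ∈ segment ℝ x (γ a) := by
        rw [segment_eq_image']
        exact ⟨s - (a - 1), ⟨by linarith [hs.1], by linarith [hs.2]⟩, rfl⟩
      calc _ ≤ √(M * ‖γ a - x‖ ^ 2) := Real.sqrt_le_sqrt (hquad _ hmem _)
        _ = √M * ‖γ a - x‖ := by rw [Real.sqrt_mul hM, Real.sqrt_sq (norm_nonneg _)]
    calc _ ≤ ∫ _ in (a - 1)..a, √M * ‖x - γ a‖ := by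
          refine intervalIntegral.integral_mono_on_of_le_Ioo hle
            (hint.mono_set (hsub (a - 1) a le_rfl hle hab)) (by simp) hb
      _ = _ := by simp
  · rw [riemannLength_eq]
    refine intervalIntegral.integral_congr_ae (Eventually.of_forall fun s hs => ?_)
    rw [uIoc_of_le hab] at hs
    have hev : prependSegment x γ a =ᶠ[𝓝 s] γ := by
      filter_upwards [Ioi_mem_nhds hs.1] with r hr using prependSegment_of_ge x (le_of_lt hr)
    rw [hev.deriv_eq, prependSegment_of_ge x hs.1.le]

end prependSegment

/-! ### The Riemannian distance as an infimum -/

section riemannDist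

variable {n : ℕ} {P : StateSpace n → Matrix (Fin n) (Fin n) ℝ}

theorem riemannLength_nonneg (γ : ℝ → StateSpace n) {a b : ℝ} (hab : a ≤ b) :
    0 ≤ riemannLength P γ a b := by
  rw [riemannLength_eq]
  exact intervalIntegral.integral_nonneg hab fun _ _ => Real.sqrt_nonneg _

theorem riemannDist_nonneg (x y : StateSpace n) : 0 ≤ riemannDist P x y := by
  refine Real.sInf_nonneg ?_
  rintro _ ⟨a, b, γ, hab, -, -, -, rfl⟩
  exact riemannLength_nonneg γ hab

theorem riemannDist_le_riemannLength {γ : ℝ → StateSpace n} {a b : ℝ} (hab : a ≤ b)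
    (hγ : IsPiecewiseC1 γ a b) : riemannDist P (γ a) (γ b) ≤ riemannLength P γ a b := by
  refine csInf_le ⟨0, ?_⟩ ⟨a, b, γ, hab, hγ, rfl, rfl, rfl⟩
  rintro _ ⟨a, b, γ, hab, -, -, -, rfl⟩
  exact riemannLength_nonneg γ hab

theorem exists_path_length_lt {x y : StateSpace n} {c : ℝ} (hc : riemannDist P x y < c) :
    ∃ (a b : ℝ) (γ : ℝ → StateSpace n), a ≤ b ∧ IsPiecewiseC1 γ a b ∧ γ a = x ∧ γ b = y ∧
      riemannLength P γ a b < c := by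
  -- The straight segment, obtained by prepending to a constant path, shows that the infimum is over
  -- a nonempty set.
  have hne : {l : ℝ | ∃ (a b : ℝ) (γ : ℝ → StateSpace n), a ≤ b ∧ IsPiecewiseC1 γ a b ∧
      γ a = x ∧ γ b = y ∧ l = riemannLength P γ a b}.Nonempty :=
    ⟨_, 0 - 1, 0, prependSegment x (fun _ => y) 0, by norm_num,
      (IsPiecewiseC1.const y 0).prependSegment x le_rfl, by simp [prependSegment],
      by simp [prependSegment], rfl⟩
  obtain ⟨_, ⟨a, b, γ, hab, hγ, ha, hb, rfl⟩, hlt⟩ := exists_lt_of_csInf_lt hne hc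
  exact ⟨a, b, γ, hab, hγ, ha, hb, hlt⟩

theorem riemannDist_self (x : StateSpace n) : riemannDist P x x = 0 := by
  refine le_antisymm ?_ (riemannDist_nonneg x x)
  simpa [riemannLength] using
    riemannDist_le_riemannLength (P := P) le_rfl (IsPiecewiseC1.const x 0)

theorem riemannDist_le_add (hP : ∀ i j, Continuous fun e => P e i j) {x y z : StateSpace n}
    {M : ℝ} (hM : 0 ≤ M) (hquad : ∀ w ∈ segment ℝ x y, ∀ v, quad (P w) v ≤ M * ‖v‖ ^ 2) :
    riemannDist P x z ≤ √M * ‖x - y‖ + riemannDist P y z := by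
  refine le_of_forall_pos_lt_add fun ε hε => ?_
  obtain ⟨a, b, γ, hab, hγ, rfl, rfl, hlt⟩ :=
    exists_path_length_lt (lt_add_of_pos_right (riemannDist P y z) hε)
  have h1 := riemannDist_le_riemannLength (P := P) (by linarith : a - 1 ≤ b)
    (hγ.prependSegment x hab)
  rw [prependSegment_of_ge x hab, prependSegment_of_le x (by linarith)] at h1
  simp only [sub_self, zero_smul, add_zero] at h1
  have h2 := riemannLength_prependSegment_le x hP hγ hab hM hquad
  linarith

end riemannDist

/-! ### Comparison of the distance with the Euclidean norm -/

/-- Two-sided bounds `p̲(|e|) I ≤ P(e) ≤ p̄(|e|) I` for a continuous matrix function `P`, with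
`p̲` non-increasing, `p̄` non-decreasing and `p̲(r) r² → ∞`. -/
structure MetricBounds {n : ℕ} (P : StateSpace n → Matrix (Fin n) (Fin n) ℝ)
    (pLow pUp : ℝ → ℝ) : Prop where
  continuous : ∀ i j, Continuous fun e => P e i j
  antitone : AntitoneOn pLow (Ici 0)
  monotone : MonotoneOn pUp (Ici 0)
  low_pos : ∀ r, 0 ≤ r → 0 < pLow r
  up_pos : ∀ r, 0 ≤ r → 0 < pUp r
  low : ∀ x v, pLow ‖x‖ * ‖v‖ ^ 2 ≤ quad (P x) v
  up : ∀ x v, quad (P x) v ≤ pUp ‖x‖ * ‖v‖ ^ 2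
  proper : Tendsto (fun r : ℝ => pLow r * r ^ 2) atTop atTop

namespace MetricBounds

variable {n : ℕ} {P : StateSpace n → Matrix (Fin n) (Fin n) ℝ} {pLow pUp : ℝ → ℝ}

theorem quad_le (h : MetricBounds P pLow pUp) {R : ℝ} {x : StateSpace n} (hx : ‖x‖ ≤ R)
    (v : StateSpace n) : quad (P x) v ≤ pUp R * ‖v‖ ^ 2 :=
  (h.up x v).trans (mul_le_mul_of_nonneg_right
    (h.monotone (norm_nonneg x) ((norm_nonneg x).trans hx) hx) (by positivity))

theorem le_sqrt_quad (h : MetricBounds P pLow pUp) {R : ℝ} {x : StateSpace n} (hx : ‖x‖ ≤ R)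
    (v : StateSpace n) : √(pLow R) * ‖v‖ ≤ √(quad (P x) v) := by
  have hR : 0 ≤ R := (norm_nonneg x).trans hx
  calc √(pLow R) * ‖v‖ = √(pLow R * ‖v‖ ^ 2) := by
        rw [Real.sqrt_mul (h.low_pos R hR).le, Real.sqrt_sq (norm_nonneg _)]
    _ ≤ _ := Real.sqrt_le_sqrt ((mul_le_mul_of_nonneg_right
        (h.antitone (norm_nonneg x) hR hx) (by positivity)).trans (h.low x v))

theorem quad_nonneg (h : MetricBounds P pLow pUp) (x v : StateSpace n) : 0 ≤ quad (P x) v :=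
  (mul_nonneg (h.low_pos _ (norm_nonneg x)).le (by positivity)).trans (h.low x v)

/-- A path that ends at the origin is at least as long as the lower bound at any of its points. -/
theorem le_riemannLength (h : MetricBounds P pLow pUp) {γ : ℝ → StateSpace n} {a b c : ℝ}
    (hγ : IsPiecewiseC1 γ a b) (hb : γ b = 0) (hc : c ∈ Icc a b) :
    √(pLow ‖γ c‖) * ‖γ c‖ ≤ riemannLength P γ a b := by
  have hcont : ContinuousOn (fun s => ‖γ s‖) (Icc c b) :=
    (hγ.1.mono (Icc_subset_Icc_left hc.1)).norm
  -- `σ` is the last time the path is at distance at least `‖γ c‖` from the origin. Afterwards it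
  -- stays in that ball, where `pLow ‖γ c‖` is a valid lower bound, and it still has to cover a
  -- Euclidean distance of at least `‖γ c‖`.
  obtain ⟨σ, ⟨hσ, hσρ⟩, hmax⟩ : ∃ σ, IsGreatest (Icc c b ∩ (fun s => ‖γ s‖) ⁻¹' Ici ‖γ c‖) σ :=
    (isCompact_Icc.of_isClosed_subset (hcont.preimage_isClosed_of_isClosed isClosed_Icc isClosed_Ici)
      inter_subset_left).exists_isGreatest ⟨c, ⟨le_rfl, hc.2⟩, le_rfl (a := ‖γ c‖)⟩
  have haσ : a ≤ σ := hc.1.trans hσ.1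
  have hsub : uIcc σ b ⊆ uIcc a b := by
    rw [uIcc_of_le hσ.2, uIcc_of_le (haσ.trans hσ.2)]
    exact Icc_subset_Icc_left haσ
  have hi := hγ.intervalIntegrable_sqrt_quad h.continuous
  calc √(pLow ‖γ c‖) * ‖γ c‖ ≤ √(pLow ‖γ c‖) * ‖γ b - γ σ‖ := by
        rw [hb, zero_sub, norm_neg]
        exact mul_le_mul_of_nonneg_left hσρ (Real.sqrt_nonneg _)
    _ ≤ √(pLow ‖γ c‖) * ∫ s in σ..b, ‖deriv γ s‖ :=
        mul_le_mul_of_nonneg_left (hγ.norm_sub_le haσ hσ.2) (Real.sqrt_nonneg _)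
    _ = ∫ s in σ..b, √(pLow ‖γ c‖) * ‖deriv γ s‖ := by
        rw [intervalIntegral.integral_const_mul]
    _ ≤ ∫ s in σ..b, √(quad (P (γ s)) (deriv γ s)) := by
        refine intervalIntegral.integral_mono_on_of_le_Ioo hσ.2
          ((hγ.intervalIntegrable_norm_deriv.mono_set hsub).const_mul _)
          (hi.mono_set hsub) fun s hs => h.le_sqrt_quad ?_ _
        by_contra hlt
        exact (hmax ⟨⟨hσ.1.trans hs.1.le, hs.2.le⟩, (not_le.1 hlt).le⟩).not_gt hs.1
    _ ≤ ∫ s in a..b, √(quad (P (γ s)) (deriv γ s)) :=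
        intervalIntegral.integral_mono_interval haσ hσ.2 le_rfl
          (Eventually.of_forall fun _ => Real.sqrt_nonneg _) hi

theorem le_riemannDist (h : MetricBounds P pLow pUp) (x : StateSpace n) :
    √(pLow ‖x‖) * ‖x‖ ≤ riemannDist P x 0 := by
  refine le_of_forall_gt fun c hc => ?_
  obtain ⟨a, b, γ, hab, hγ, rfl, hb, hlt⟩ := exists_path_length_lt hc
  exact (h.le_riemannLength hγ hb ⟨le_rfl, hab⟩).trans_lt hlt

theorem riemannDist_le (h : MetricBounds P pLow pUp) {R : ℝ} {x y : StateSpace n}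
    (hx : ‖x‖ ≤ R) (hy : ‖y‖ ≤ R) :
    riemannDist P x 0 ≤ √(pUp R) * ‖x - y‖ + riemannDist P y 0 := by
  refine riemannDist_le_add h.continuous (h.up_pos R ((norm_nonneg x).trans hx)).le
    fun w hw v => h.quad_le ?_ v
  have := (convex_closedBall (0 : StateSpace n) R).segment_subset
    (mem_closedBall_zero_iff.2 hx) (mem_closedBall_zero_iff.2 hy) hw
  exact mem_closedBall_zero_iff.1 this

theorem abs_riemannDist_sub_le (h : MetricBounds P pLow pUp) {R : ℝ} {x y : StateSpace n}
    (hx : ‖x‖ ≤ R) (hy : ‖y‖ ≤ R) :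
    |riemannDist P x 0 - riemannDist P y 0| ≤ √(pUp R) * ‖x - y‖ := by
  have h1 := h.riemannDist_le hx hy
  have h2 := h.riemannDist_le hy hx
  rw [norm_sub_rev] at h2
  exact abs_le.2 ⟨by linarith, by linarith⟩

theorem riemannDist_le_mul_norm (h : MetricBounds P pLow pUp) (x : StateSpace n) :
    riemannDist P x 0 ≤ √(pUp ‖x‖) * ‖x‖ := by
  have := h.riemannDist_le (y := 0) le_rfl ((norm_zero (E := StateSpace n)).trans_le (norm_nonneg x))
  simpa [riemannDist_self] using this

theorem continuous_riemannDist (h : MetricBounds P pLow pUp) :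
    Continuous fun x => riemannDist P x 0 := by
  refine continuous_iff_continuousAt.2 fun x => ?_
  refine tendsto_iff_dist_tendsto_zero.2 ?_
  have hlim : Tendsto (fun y => √(pUp (‖x‖ + 1)) * ‖y - x‖) (𝓝 x) (𝓝 0) := by
    have : Continuous fun y => √(pUp (‖x‖ + 1)) * ‖y - x‖ := by fun_prop
    simpa using this.tendsto x
  refine squeeze_zero' (Eventually.of_forall fun _ => dist_nonneg) ?_ hlim
  filter_upwards [Metric.ball_mem_nhds x one_pos] with y hy
  rw [Real.dist_eq]
  refine h.abs_riemannDist_sub_le ?_ (by linarith)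
  rw [mem_ball_iff_norm] at hy
  have := norm_le_norm_add_norm_sub' y x
  linarith

theorem riemannDist_pos (h : MetricBounds P pLow pUp) {x : StateSpace n} (hx : x ≠ 0) :
    0 < riemannDist P x 0 :=
  (mul_pos (Real.sqrt_pos.2 (h.low_pos _ (norm_nonneg x))) (norm_pos_iff.2 hx)).trans_le
    (h.le_riemannDist x)

/-- This is the only place where `p̲(r) r² → ∞` enters. It confines sublevel sets of `V`, and all
short paths to the origin, to a ball. -/
theorem exists_radius (h : MetricBounds P pLow pUp) (M : ℝ) :
    ∃ R, 0 < R ∧ ∀ x : StateSpace n, √(pLow ‖x‖) * ‖x‖ ≤ M → ‖x‖ ≤ R := by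
  obtain ⟨R, hR⟩ := eventually_atTop.1 (h.proper.eventually_gt_atTop (M ^ 2))
  refine ⟨max R 1, by positivity, fun x hx => ?_⟩
  by_contra hlt
  have h1 := hR ‖x‖ ((le_max_left _ _).trans (not_le.1 hlt).le)
  have h2 : (√(pLow ‖x‖) * ‖x‖) ^ 2 ≤ M ^ 2 := pow_le_pow_left₀ (by positivity) hx 2
  rw [mul_pow, Real.sq_sqrt (h.low_pos _ (norm_nonneg x)).le] at h2
  linarith

theorem tendsto_riemannDist (h : MetricBounds P pLow pUp) :
    Tendsto (fun x => riemannDist P x 0) (Bornology.cobounded (StateSpace n)) atTop := by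
  refine tendsto_atTop.2 fun M => ?_
  obtain ⟨R, -, hR⟩ := h.exists_radius M
  filter_upwards [tendsto_norm_cobounded_atTop.eventually_gt_atTop R] with x hx
  by_contra hlt
  exact hx.not_ge (hR x ((h.le_riemannDist x).trans (not_le.1 hlt).le))

end MetricBounds

/-! ### Contraction by an Euler step -/

/-- The derivative of `h ↦ (w + h u)ᵀ P(y + h f) (w + h u)` at `h = 0`. -/
def quadDeriv {n : ℕ} (P : StateSpace n → Matrix (Fin n) (Fin n) ℝ)
    (y w f u : StateSpace n) : ℝ :=
  ∑ i, ∑ j, ((u i * P y i j + w i * fderiv ℝ (fun e => P e i j) y f) * w j + w i * P y i j * u j)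

section

variable {n : ℕ} {P : StateSpace n → Matrix (Fin n) (Fin n) ℝ}
  {F : StateSpace n → StateSpace n} {pLow pUp : ℝ → ℝ}

theorem hasDerivAt_quad_line (hP : ∀ i j, ContDiff ℝ 1 fun e => P e i j)
    (x v f u : StateSpace n) (h : ℝ) :
    HasDerivAt (fun h : ℝ => quad (P (x + h • f)) (v + h • u))
      (quadDeriv P (x + h • f) (v + h • u) f u) h := by
  simp only [quad_eq_sum, quadDeriv]
  refine HasDerivAt.fun_sum fun i _ => HasDerivAt.fun_sum fun j _ => ?_
  have hw : ∀ k, HasDerivAt (fun h : ℝ => (v + h • u) k) (u k) h := fun k => by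
    simpa using ((hasDerivAt_id h).mul_const (u k)).const_add (v k)
  have hl : HasDerivAt (fun h : ℝ => x + h • f) f h := by
    simpa using ((hasDerivAt_id h).smul_const f).const_add x
  have hp : HasDerivAt (fun h : ℝ => P (x + h • f) i j)
      (fderiv ℝ (fun e => P e i j) (x + h • f) f) h := by
    have hd : HasFDerivAt (fun e => P e i j) (fderiv ℝ (fun e => P e i j) (x + h • f))
        (x + h • f) := ((hP i j).differentiable one_ne_zero _).hasFDerivAt
    exact hd.comp_hasDerivAt h hl
  exact ((hw i).mul hp).mul (hw j)

theorem continuous_quadDeriv_comp (hP : ∀ i j, ContDiff ℝ 1 fun e => P e i j)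
    {X : Type*} [TopologicalSpace X] {y w f u : X → StateSpace n} (hy : Continuous y)
    (hw : Continuous w) (hf : Continuous f) (hu : Continuous u) :
    Continuous fun z => quadDeriv P (y z) (w z) (f z) (u z) := by
  have h1 : ∀ i j, Continuous fun z => P (y z) i j := fun i j => (hP i j).continuous.comp hy
  have h2 : ∀ i j, Continuous fun z => fderiv ℝ (fun e => P e i j) (y z) (f z) := fun i j =>
    (((hP i j).continuous_fderiv one_ne_zero).comp hy).clm_apply hf
  unfold quadDeriv
  fun_prop

/-- Uniformly on a ball, an Euler step of `F` contracts the metric `P` to first order. -/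
theorem quad_euler_le (hP : ∀ i j, ContDiff ℝ 1 fun e => P e i j) (hF : ContDiff ℝ 1 F)
    {μ κ : ℝ} (hneg : ∀ x v, quadDeriv P x v (F x) (fderiv ℝ F x v) ≤ -μ * ‖v‖ ^ 2)
    (hκ : κ < μ) (R : ℝ) :
    ∀ᶠ h in 𝓝[>] (0 : ℝ), ∀ x, ‖x‖ ≤ R → ∀ v,
      quad (P (x + h • F x)) (v + h • fderiv ℝ F x v) ≤ quad (P x) v - h * κ * ‖v‖ ^ 2 := by
  set θ : ℝ → StateSpace n × StateSpace n → ℝ := fun h z =>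
    quadDeriv P (z.1 + h • F z.1) (z.2 + h • fderiv ℝ F z.1 z.2) (F z.1) (fderiv ℝ F z.1 z.2)
    with hθ
  have hFc := hF.continuous
  have hDF : Continuous fun p : ℝ × StateSpace n × StateSpace n => fderiv ℝ F p.2.1 p.2.2 :=
    ((hF.continuous_fderiv one_ne_zero).comp (by fun_prop)).clm_apply (by fun_prop)
  have hcont : Continuous fun p : ℝ × StateSpace n × StateSpace n => θ p.1 p.2 :=
    continuous_quadDeriv_comp hP (by fun_prop) (by fun_prop) (by fun_prop) hDF
  -- Homogeneity in `v` allows restriction to unit vectors. On this compact set the strict bound `θ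
  -- 0 z < -κ` persists for all small `h` uniformly in `z`.
  set K := Metric.closedBall (0 : StateSpace n) R ×ˢ Metric.sphere (0 : StateSpace n) 1
  have hK : IsCompact K := (isCompact_closedBall 0 R).prod (isCompact_sphere 0 1)
  have hev : ∀ᶠ h in 𝓝 (0 : ℝ), ∀ z ∈ K, θ h z < -κ := by
    refine hK.eventually_forall_of_forall_eventually fun z hz => ?_
    refine hcont.continuousAt.eventually_lt continuousAt_const ?_
    have := hneg z.1 z.2
    have h1 : ‖z.2‖ = 1 := mem_sphere_zero_iff_norm.1 hz.2
    rw [h1] at this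
    simp only [hθ, zero_smul, add_zero]
    linarith
  obtain ⟨δ, hδ, hball⟩ := Metric.eventually_nhds_iff.1 hev
  filter_upwards [Ioo_mem_nhdsGT hδ] with h hh x hx v
  rcases eq_or_ne v 0 with rfl | hv
  · have h0 : ∀ M : Matrix (Fin n) (Fin n) ℝ, quad M 0 = 0 := fun M => by simp [quad]
    simp [h0]
  have hunit : ∀ u : StateSpace n, ‖u‖ = 1 →
      quad (P (x + h • F x)) (u + h • fderiv ℝ F x u) ≤ quad (P x) u - h * κ := by
    intro u hu
    have hd := hasDerivAt_quad_line hP x u (F x) (fderiv ℝ F x u)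
    have := (convex_Icc 0 h).image_sub_le_mul_sub_of_deriv_le
      (fun s _ => (hd s).continuousAt.continuousWithinAt)
      (fun s _ => (hd s).differentiableAt.differentiableWithinAt) (C := -κ) (fun s hs => by
        rw [interior_Icc] at hs
        rw [(hd s).deriv]
        refine (hball ?_ (x, u) ⟨mem_closedBall_zero_iff.2 hx, mem_sphere_zero_iff_norm.2 hu⟩).le
        rw [Real.dist_eq, sub_zero, abs_of_pos hs.1]
        exact hs.2.trans hh.2) 0 ⟨le_rfl, hh.1.le⟩ h ⟨hh.1.le, le_rfl⟩ hh.1.le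
    simp only [zero_smul, add_zero, sub_zero] at this
    linarith
  have hv0 : ‖v‖ ≠ 0 := norm_ne_zero_iff.2 hv
  obtain ⟨c, u, hu, rfl⟩ : ∃ (c : ℝ) (u : StateSpace n), ‖u‖ = 1 ∧ v = c • u :=
    ⟨‖v‖, ‖v‖⁻¹ • v, by simp [norm_smul, hv0], by simp [smul_smul, hv0]⟩
  have := mul_le_mul_of_nonneg_left (hunit u hu) (sq_nonneg c)
  rw [map_smul, smul_comm h c, ← smul_add, quad_smul, quad_smul, norm_smul, hu, mul_one,
    Real.norm_eq_abs, sq_abs]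
  linarith

/-- For `g > 0`, `√(g² - c m²) ≤ g - c m² / (2g)`, and `m² / g ≥ 2 l m - l² g` because `(m - l g)² ≥
0`. The bound is linear in `g` and `m`, so it can be integrated along a path with `l` constant. -/
theorem sqrt_le_of_sq_sub {w g m c l : ℝ} (hg : 0 ≤ g) (hw : 0 ≤ w) (hc : 0 ≤ c) (hl : 0 ≤ l)
    (h : w ≤ g ^ 2 - c * m ^ 2) : √w ≤ (1 + c * l ^ 2 / 2) * g - c * l * m := by
  -- With `c = s²`, the right side is at least `g (1 - s l + (s l)² / 2) ≥ 0`, and its square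
  -- exceeds `g² - c m²` by a sum of squares.
  obtain ⟨s, hs, rfl⟩ : ∃ s, 0 ≤ s ∧ c = s ^ 2 := ⟨√c, Real.sqrt_nonneg c, (Real.sq_sqrt hc).symm⟩
  have hsm : s * m ≤ g := by
    refine (abs_le_of_sq_le_sq' ?_ hg).2
    rw [mul_pow]; linarith
  refine Real.sqrt_le_iff.2 ⟨?_, ?_⟩
  · have h1 : s * l * (s * m) ≤ s * l * g := mul_le_mul_of_nonneg_left hsm (mul_nonneg hs hl)
    have h2 : 0 ≤ g * (1 - s * l + (s * l) ^ 2 / 2) :=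
      mul_nonneg hg (by nlinarith [sq_nonneg (s * l - 1)])
    nlinarith
  · refine h.trans ?_
    have h1 : 0 ≤ s ^ 2 * (l * g - m) ^ 2 := by positivity
    have h2 : 0 ≤ s ^ 4 * l ^ 2 * (l * g / 2 - m) ^ 2 := by positivity
    linarith [show ((1 + s ^ 2 * l ^ 2 / 2) * g - s ^ 2 * l * m) ^ 2 - (g ^ 2 - s ^ 2 * m ^ 2) =
      s ^ 2 * (l * g - m) ^ 2 + s ^ 4 * l ^ 2 * (l * g / 2 - m) ^ 2 by ring]

/-- An Euler step of a contracting vector field decreases the distance to the origin. -/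
theorem MetricBounds.riemannDist_euler_le (hB : MetricBounds P pLow pUp)
    (hP : ∀ i j, ContDiff ℝ 1 fun e => P e i j) (hF : ContDiff ℝ 1 F) (hF0 : F 0 = 0)
    {μ κ : ℝ} (hneg : ∀ x v, quadDeriv P x v (F x) (fderiv ℝ F x v) ≤ -μ * ‖v‖ ^ 2)
    (hκ0 : 0 ≤ κ) (hκ : κ < μ) (e : StateSpace n) :
    ∀ᶠ h in 𝓝[>] (0 : ℝ), riemannDist P (e + h • F e) 0 ≤
      riemannDist P e 0 - h * (κ / (2 * pUp ‖e‖) * riemannDist P e 0) := by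
  -- Every path from `e` to the origin of length at most `V + 1` stays in this ball, so the
  -- admissible `h` can be fixed before the path.
  obtain ⟨R, -, hR⟩ := hB.exists_radius (riemannDist P e 0 + 1)
  filter_upwards [quad_euler_le hP hF hneg hκ R, self_mem_nhdsWithin] with h hh (hpos : 0 < h)
  set V := riemannDist P e 0 with hV
  have hp : 0 < pUp ‖e‖ := hB.up_pos _ (norm_nonneg e)
  -- This slope turns the gain `h κ (l |e| - l² V / 2)` into at least `h κ l² V / 2`, since `V ≤ |e|
  -- / l`.
  set l : ℝ := (√(pUp ‖e‖))⁻¹ with hl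
  have hl0 : 0 ≤ l := by positivity
  have hl2 : l ^ 2 = (pUp ‖e‖)⁻¹ := by rw [hl, inv_pow, Real.sq_sqrt hp.le]
  have hc : 0 ≤ h * κ := by positivity
  have hΦ : ContDiff ℝ 1 fun x => x + h • F x := contDiff_id.add (hF.const_smul h)
  -- A shortest path need not exist: the estimate is proved along a path of length below `c`, and
  -- then `c ↘ V`.
  have key : ∀ c ∈ Ioo V (V + 1),
      riemannDist P (e + h • F e) 0 ≤ (1 + h * κ * l ^ 2 / 2) * c - h * κ * l * ‖e‖ := by
    intro c hcV
    obtain ⟨a, b, γ, hab, hγ, ha, hb, hlt⟩ := exists_path_length_lt hcV.1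
    have hΓ := hγ.comp hΦ
    have h1 := riemannDist_le_riemannLength (P := P) hab hΓ
    simp only [ha, hb, hF0, smul_zero, add_zero] at h1
    have hi := hγ.intervalIntegrable_sqrt_quad hB.continuous
    have hn := hγ.intervalIntegrable_norm_deriv
    have hnorm : ‖e‖ ≤ ∫ s in a..b, ‖deriv γ s‖ := by
      simpa [ha, hb] using hγ.norm_sub_le le_rfl hab
    calc riemannDist P (e + h • F e) 0
        ≤ ∫ s in a..b, √(quad (P (γ s + h • F (γ s))) (deriv (fun s => γ s + h • F (γ s)) s)) := h1
      _ ≤ ∫ s in a..b, ((1 + h * κ * l ^ 2 / 2) * √(quad (P (γ s)) (deriv γ s)) -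
            h * κ * l * ‖deriv γ s‖) := by
          refine intervalIntegral.integral_mono_ae_restrict hab
            (hΓ.intervalIntegrable_sqrt_quad hB.continuous)
            ((hi.const_mul _).sub (hn.const_mul _)) ?_
          rw [← restrict_Ioo_eq_restrict_Icc]
          filter_upwards [ae_restrict_mem measurableSet_Ioo,
            ae_restrict_of_ae hγ.ae_differentiableAt] with s hs hds
          have hd := (hds hs).hasDerivAt
          have hdΓ : HasDerivAt (fun s => γ s + h • F (γ s))
              (deriv γ s + h • fderiv ℝ F (γ s) (deriv γ s)) s :=
            hd.add ((((hF.differentiable one_ne_zero) (γ s)).hasFDerivAt.comp_hasDerivAt s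
              hd).const_smul h)
          rw [hdΓ.deriv]
          have hRs : ‖γ s‖ ≤ R := hR _ ((hB.le_riemannLength hγ hb ⟨hs.1.le, hs.2.le⟩).trans
            (hlt.trans hcV.2).le)
          refine sqrt_le_of_sq_sub (Real.sqrt_nonneg _) (hB.quad_nonneg _ _) hc hl0 ?_
          rw [Real.sq_sqrt (hB.quad_nonneg _ _)]
          exact hh _ hRs _
      _ = (1 + h * κ * l ^ 2 / 2) * riemannLength P γ a b -
            h * κ * l * ∫ s in a..b, ‖deriv γ s‖ := by
          rw [intervalIntegral.integral_sub (hi.const_mul _) (hn.const_mul _),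
            intervalIntegral.integral_const_mul, intervalIntegral.integral_const_mul,
            riemannLength_eq]
      _ ≤ _ := sub_le_sub (mul_le_mul_of_nonneg_left hlt.le (by positivity))
          (mul_le_mul_of_nonneg_left hnorm (by positivity))
  have hlim : riemannDist P (e + h • F e) 0 ≤
      (1 + h * κ * l ^ 2 / 2) * V - h * κ * l * ‖e‖ := by
    have ht : Tendsto (fun c : ℝ => (1 + h * κ * l ^ 2 / 2) * c - h * κ * l * ‖e‖) (𝓝[>] V)
        (𝓝 ((1 + h * κ * l ^ 2 / 2) * V - h * κ * l * ‖e‖)) :=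
      (Continuous.tendsto (by fun_prop) V).mono_left nhdsWithin_le_nhds
    refine ge_of_tendsto ht ?_
    filter_upwards [Ioo_mem_nhdsGT (lt_add_one V)] with c hc using key c hc
  have hVe : l ^ 2 * V ≤ l * ‖e‖ := by
    have := mul_le_mul_of_nonneg_left (hB.riemannDist_le_mul_norm e) (sq_nonneg l)
    have hll : l * √(pUp ‖e‖) = 1 := inv_mul_cancel₀ (Real.sqrt_pos.2 hp).ne'
    calc l ^ 2 * V ≤ l * (l * √(pUp ‖e‖)) * ‖e‖ := by rw [hV]; linarith
      _ = _ := by rw [hll, mul_one]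
  have h3 := mul_le_mul_of_nonneg_left hVe hc
  have h4 : κ / (2 * pUp ‖e‖) * V = κ * l ^ 2 * V / 2 := by rw [hl2]; field_simp
  rw [h4]
  linarith

end

/-! ### Decrease of the distance along solutions -/

theorem MetricBounds.exists_abs_slope_le {n : ℕ} {P : StateSpace n → Matrix (Fin n) (Fin n) ℝ}
    {pLow pUp : ℝ → ℝ} (h : MetricBounds P pLow pUp) {y : ℝ → StateSpace n} {v : StateSpace n}
    {t : ℝ} (hy : HasDerivWithinAt y v (Ici t) t) :
    ∃ C, ∀ᶠ z in 𝓝[>] t, |slope (fun s => riemannDist P (y s) 0) t z| ≤ C := by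
  obtain ⟨C, hC⟩ := (hy.hasFDerivWithinAt.isBigO_sub.mono
    (nhdsWithin_mono t Ioi_subset_Ici_self)).bound
  refine ⟨√(pUp (‖y t‖ + 1)) * C, ?_⟩
  have hnear : ∀ᶠ z in 𝓝[>] t, ‖y z‖ < ‖y t‖ + 1 :=
    (hy.continuousWithinAt.mono Ioi_subset_Ici_self).norm.eventually_lt
      continuousWithinAt_const (lt_add_one _)
  filter_upwards [hC, hnear, self_mem_nhdsWithin] with z hz hzn (hzt : t < z)
  have hpos : 0 < z - t := sub_pos.2 hzt
  rw [slope_def_field, abs_div, abs_of_pos hpos, div_le_iff₀ hpos]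
  rw [Real.norm_eq_abs, abs_of_pos hpos] at hz
  refine (h.abs_riemannDist_sub_le hzn.le (by linarith)).trans ?_
  rw [mul_assoc]
  exact mul_le_mul_of_nonneg_left hz (Real.sqrt_nonneg _)

/-- The matrix function `P` is a metric with bounds `p̲`, `p̄` in which the flow of `F` contracts:
`d_F P + P ∂F/∂e + (∂F/∂e)ᵀ P ≤ -μ I`. -/
structure IsContractionMetric {n : ℕ} (F : StateSpace n → StateSpace n)
    (P : StateSpace n → Matrix (Fin n) (Fin n) ℝ) (pLow pUp : ℝ → ℝ) (μ : ℝ) : Prop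
    extends MetricBounds P pLow pUp where
  contDiff_metric : ∀ i j, ContDiff ℝ 1 fun e => P e i j
  contDiff_field : ContDiff ℝ 1 F
  field_zero : F 0 = 0
  rate_pos : 0 < μ
  contracts : ∀ x v, quadDeriv P x v (F x) (fderiv ℝ F x v) ≤ -μ * ‖v‖ ^ 2

namespace IsContractionMetric

variable {n : ℕ} {F : StateSpace n → StateSpace n}
  {P : StateSpace n → Matrix (Fin n) (Fin n) ℝ} {pLow pUp : ℝ → ℝ} {μ : ℝ}

/-- The curve departs from its Euler step by `o(z - t)`, which costs `V` only `o(z - t)` by the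
local Lipschitz bound. Any `κ < μ` close enough to `μ` leaves a positive `gap` to absorb this error.
-/
theorem eventually_slope_lt (h : IsContractionMetric F P pLow pUp μ) {y : ℝ → StateSpace n}
    {t r : ℝ} (hy : HasDerivWithinAt y (F (y t)) (Ici t) t)
    (hr : -(μ / (2 * pUp ‖y t‖)) * riemannDist P (y t) 0 < r) :
    ∀ᶠ z in 𝓝[>] t, slope (fun s => riemannDist P (y s) 0) t z < r := by
  set e := y t with he
  set V := riemannDist P e 0 with hV
  obtain ⟨κ, hκr, hκ⟩ : ∃ κ, -(κ / (2 * pUp ‖e‖)) * V < r ∧ κ ∈ Ioo 0 μ := by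
    have hc : Continuous fun κ : ℝ => -(κ / (2 * pUp ‖e‖)) * V := by fun_prop
    have h1 : ∀ᶠ κ in 𝓝[<] μ, -(κ / (2 * pUp ‖e‖)) * V < r :=
      nhdsWithin_le_nhds (hc.continuousAt.eventually_lt continuousAt_const hr)
    exact (h1.and (Ioo_mem_nhdsLT h.rate_pos)).exists
  set M := √(pUp (‖e‖ + 1)) with hM
  have hM0 : 0 ≤ M := Real.sqrt_nonneg _
  set gap := r - -(κ / (2 * pUp ‖e‖)) * V with hgap
  have hgap0 : 0 < gap := sub_pos.2 hκr
  have hε : 0 < gap / (M + 1) := by positivity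
  have hshift : Tendsto (fun z : ℝ => z - t) (𝓝[>] t) (𝓝[>] 0) := by
    refine tendsto_nhdsWithin_iff.2 ⟨?_, ?_⟩
    · have : Continuous fun z : ℝ => z - t := by fun_prop
      simpa using (this.tendsto t).mono_left nhdsWithin_le_nhds
    · filter_upwards [self_mem_nhdsWithin] with z hz using sub_pos.2 (mem_Ioi.1 hz)
  have heuler := hshift.eventually (h.riemannDist_euler_le h.contDiff_metric h.contDiff_field
    h.field_zero h.contracts hκ.1.le hκ.2 e)
  have hsmall := ((hasDerivWithinAt_iff_isLittleO.1 hy).mono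
    (nhdsWithin_mono t Ioi_subset_Ici_self)).bound hε
  have hnear : ∀ᶠ z in 𝓝[>] t, ‖y z‖ < ‖e‖ + 1 :=
    (hy.continuousWithinAt.mono Ioi_subset_Ici_self).norm.eventually_lt
      continuousWithinAt_const (lt_add_one _)
  have hnear' : ∀ᶠ z in 𝓝[>] t, ‖e + (z - t) • F e‖ < ‖e‖ + 1 := by
    have hc : Continuous fun z : ℝ => ‖e + (z - t) • F e‖ := by fun_prop
    exact nhdsWithin_le_nhds (hc.continuousAt.eventually_lt continuousAt_const (by simp))
  filter_upwards [heuler, hsmall, hnear, hnear', self_mem_nhdsWithin] with z h1 h2 h3 h4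
    (hzt : t < z)
  have hpos : 0 < z - t := sub_pos.2 hzt
  rw [slope_def_field, div_lt_iff₀ hpos]
  change riemannDist P (y z) 0 - V < _
  have h5 := h.riemannDist_le h3.le h4.le
  rw [Real.norm_eq_abs, abs_of_pos hpos, sub_sub] at h2
  have h6 : M * ‖y z - (e + (z - t) • F e)‖ ≤ M * (gap / (M + 1) * (z - t)) :=
    mul_le_mul_of_nonneg_left h2 hM0
  have h7 : M * (gap / (M + 1)) < gap := by
    rw [mul_div_assoc', div_lt_iff₀ (by positivity)]
    linarith
  have h8 := mul_lt_mul_of_pos_right h7 hpos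
  have h9 : r = gap - κ / (2 * pUp ‖e‖) * V := by rw [hgap]; ring
  rw [h9]
  linarith

/-- Exponential decay of the distance to the origin along a curve that solves `ẋ = F(x)` as long
as it stays in a ball containing a sublevel set. -/
theorem riemannDist_le_exp (h : IsContractionMetric F P pLow pUp μ) {R M c : ℝ}
    {x x' : ℝ → StateSpace n} (hM : 0 < M) (hR : ∀ z, riemannDist P z 0 ≤ M → ‖z‖ ≤ R)
    (hcont : ContinuousOn x (Ici 0)) (hx : ∀ t, 0 ≤ t → HasDerivWithinAt x (x' t) (Ici t) t)
    (hF : ∀ t, 0 ≤ t → ‖x t‖ ≤ R → x' t = F (x t)) (h0 : riemannDist P (x 0) 0 ≤ M)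
    (hc0 : 0 ≤ c) (hc : c < μ / (2 * pUp R)) {t : ℝ} (ht : 0 ≤ t) :
    riemannDist P (x t) 0 ≤ M * Real.exp (-c * t) := by
  -- The comparison theorem wants a slope bound `d` at every time but inspects its value only where
  -- `V` touches the exponential. There `V ≤ M`, so the curve is in the ball; outside the ball any
  -- Lipschitz bound will do.
  have hex : ∀ s, ∃ d, 0 ≤ s →
      (∀ r, d < r → ∃ᶠ z in 𝓝[>] s, slope (fun s => riemannDist P (x s) 0) s z < r) ∧
      (‖x s‖ ≤ R → d ≤ -(μ / (2 * pUp ‖x s‖)) * riemannDist P (x s) 0) := by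
    intro s
    rcases lt_or_ge s 0 with hs | hs
    · exact ⟨0, fun h => absurd h hs.not_ge⟩
    by_cases hsR : ‖x s‖ ≤ R
    · refine ⟨_, fun _ => ⟨fun r hr => ?_, fun _ => le_rfl⟩⟩
      exact (h.eventually_slope_lt (hF s hs hsR ▸ hx s hs) hr).frequently
    · obtain ⟨C, hC⟩ := h.exists_abs_slope_le (hx s hs)
      refine ⟨C, fun _ => ⟨fun r hr => ?_, fun h => absurd h hsR⟩⟩
      exact (hC.mono fun z hz => (abs_le.1 hz).2.trans_lt hr).frequently
  choose d hd using hex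
  have hB : ∀ s, HasDerivAt (fun s => M * Real.exp (-c * s)) (M * (Real.exp (-c * s) * -c)) s := by
    intro s
    simpa using ((((hasDerivAt_id s).const_mul (-c)).exp).const_mul M)
  refine image_le_of_liminf_slope_right_lt_deriv_boundary' (a := 0) (b := t) (f' := d)
    (h.continuous_riemannDist.comp_continuousOn (hcont.mono Icc_subset_Ici_self))
    (fun s hs => (hd s hs.1).1) (by simpa using h0)
    (fun s _ => (hB s).continuousAt.continuousWithinAt)
    (fun s _ => (hB s).hasDerivWithinAt) ?_ ⟨ht, le_rfl⟩
  intro s hs hVs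
  change riemannDist P (x s) 0 = M * Real.exp (-c * s) at hVs
  -- Positivity of `V` at a contact time, which comes from `M > 0`, makes the required slope
  -- inequality strict.
  have hVpos : 0 < riemannDist P (x s) 0 := hVs ▸ by positivity
  have hVM : riemannDist P (x s) 0 ≤ M := by
    rw [hVs]
    exact mul_le_of_le_one_right hM.le (Real.exp_le_one_iff.2 (by nlinarith [hs.1]))
  have hxR := hR _ hVM
  have hR0 : 0 ≤ R := (norm_nonneg _).trans hxR
  have hpp : pUp ‖x s‖ ≤ pUp R := h.monotone (norm_nonneg _) hR0 hxR
  have hp := h.up_pos _ (norm_nonneg (x s))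
  have hμ := h.rate_pos
  have hrate : c < μ / (2 * pUp ‖x s‖) :=
    hc.trans_le (div_le_div_of_nonneg_left hμ.le (by positivity) (by linarith))
  have := (hd s hs.1).2 hxR
  have h2 := mul_lt_mul_of_pos_right hrate hVpos
  have h3 : M * (Real.exp (-c * s) * -c) = -(c * riemannDist P (x s) 0) := by rw [hVs]; ring
  rw [h3]
  linarith

/-- The derivative `x'` is tied to `F` only inside the `R`-ball, so the bound also covers solutions
of a field modified outside it. The constants depend on the curve only through `r`. -/
theorem exists_exp_bound (h : IsContractionMetric F P pLow pUp μ) {r : ℝ} (hr : 0 ≤ r) :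
    ∃ R k lam : ℝ, 0 < R ∧ 0 < k ∧ 0 < lam ∧ ∀ x x' : ℝ → StateSpace n, ‖x 0‖ ≤ r →
      ContinuousOn x (Ici 0) → (∀ t, 0 ≤ t → HasDerivWithinAt x (x' t) (Ici t) t) →
      (∀ t, 0 ≤ t → ‖x t‖ ≤ R → x' t = F (x t)) →
      ∀ t, 0 ≤ t → ‖x t‖ ≤ R ∧ ‖x t‖ ≤ k * Real.exp (-lam * t) * ‖x 0‖ := by
  obtain ⟨R, hR0, hR⟩ := h.exists_radius (√(pUp r) * r + 1)
  have hpR := h.up_pos R hR0.le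
  have hpr := h.up_pos r hr
  have hlR := h.low_pos R hR0.le
  have hμ := h.rate_pos
  -- Halving provides the strict inequality of rates needed in `riemannDist_le_exp`.
  set lam := μ / (2 * pUp R) / 2 with hlam
  have hlam0 : 0 < lam := by positivity
  have hlamlt : lam < μ / (2 * pUp R) := half_lt_self (by positivity)
  refine ⟨R, √(pUp r) / √(pLow R), lam, hR0, by positivity, hlam0, ?_⟩
  intro x x' hx0 hcont hx hF t ht
  have hV0 : riemannDist P (x 0) 0 ≤ √(pUp r) * ‖x 0‖ :=
    (h.riemannDist_le_mul_norm _).trans (mul_le_mul_of_nonneg_right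
      (Real.sqrt_le_sqrt (h.monotone (norm_nonneg _) hr hx0)) (norm_nonneg _))
  have hV0r : riemannDist P (x 0) 0 ≤ √(pUp r) * r :=
    hV0.trans (mul_le_mul_of_nonneg_left hx0 (Real.sqrt_nonneg _))
  have hexp1 : Real.exp (-lam * t) ≤ 1 := Real.exp_le_one_iff.2 (by nlinarith)
  -- The comparison needs a positive initial level, so `V (x 0)` is raised by `min ε 1`; the `+ 1`
  -- in the choice of `R` leaves room for this.
  have hV : riemannDist P (x t) 0 ≤ riemannDist P (x 0) 0 * Real.exp (-lam * t) := by
    refine le_of_forall_pos_le_add fun ε hε => ?_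
    have hδ : 0 < min ε 1 := lt_min hε one_pos
    have := h.riemannDist_le_exp (R := R) (M := riemannDist P (x 0) 0 + min ε 1)
      (add_pos_of_nonneg_of_pos (riemannDist_nonneg _ _) hδ)
      (fun z hz => hR z ((h.le_riemannDist z).trans
        (hz.trans (add_le_add hV0r (min_le_right _ _)))))
      hcont hx hF (by linarith) hlam0.le hlamlt ht
    have h2 : min ε 1 * Real.exp (-lam * t) ≤ ε :=
      (mul_le_of_le_one_right hδ.le hexp1).trans (min_le_left _ _)
    linarith
  have hxR : ‖x t‖ ≤ R := by
    refine hR _ ((h.le_riemannDist _).trans (hV.trans ?_))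
    linarith [mul_le_of_le_one_right (riemannDist_nonneg (P := P) (x 0) 0) hexp1]
  refine ⟨hxR, ?_⟩
  have h1 : √(pLow R) * ‖x t‖ ≤ √(pLow ‖x t‖) * ‖x t‖ :=
    mul_le_mul_of_nonneg_right (Real.sqrt_le_sqrt (h.antitone (norm_nonneg _) hR0.le hxR))
      (norm_nonneg _)
  have h2 : √(pLow R) * ‖x t‖ ≤ √(pUp r) * ‖x 0‖ * Real.exp (-lam * t) :=
    (h1.trans (h.le_riemannDist _)).trans (hV.trans
      (mul_le_mul_of_nonneg_right hV0 (Real.exp_pos _).le))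
  have hs : 0 < √(pLow R) := Real.sqrt_pos.2 hlR
  calc ‖x t‖ ≤ √(pUp r) * ‖x 0‖ * Real.exp (-lam * t) / √(pLow R) := by
        rw [le_div_iff₀ hs]; linarith
    _ = _ := by ring

end IsContractionMetric

/-! ### Forward completeness and stability -/

/-- A bounded, globally Lipschitz vector field is forward complete. -/
theorem LipschitzWith.exists_isIntegralCurveOn_Ici {E : Type*} [NormedAddCommGroup E]
    [NormedSpace ℝ E] [CompleteSpace E] {g : E → E} {K L : NNReal} (hg : LipschitzWith K g)
    (hL : ∀ x, ‖g x‖ ≤ L) (e : E) :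
    ∃ x : ℝ → E, x 0 = e ∧ IsIntegralCurveOn x (fun _ => g) (Ici 0) := by
  have hloc : ∀ N : ℕ, ∃ α : ℝ → E, α 0 = e ∧
      ∀ t ∈ Icc (0 : ℝ) N, HasDerivWithinAt α (g (α t)) (Icc (0 : ℝ) N) t := by
    intro N
    -- Speed at most `L` keeps the solution within `L * N` of `e` up to time `N`, so Picard–Lindelöf
    -- applies on the whole interval at once.
    have hPL : IsPicardLindelof (fun _ => g) (tmin := 0) (tmax := N) ⟨0, le_rfl, N.cast_nonneg⟩
        e (L * N) 0 L K :=
      IsPicardLindelof.of_time_independent (fun x _ => hL x) hg.lipschitzOnWith (by simp)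
    exact hPL.exists_eq_forall_mem_Icc_hasDerivWithinAt₀
  choose α hα0 hα using hloc
  have hright : ∀ N N' : ℕ, N ≤ N' → ∀ t ∈ Ico (0 : ℝ) N,
      HasDerivWithinAt (α N') (g (α N' t)) (Ici t) t := by
    intro N N' hNN t ht
    have hlt : t < N' := ht.2.trans_le (by exact_mod_cast hNN)
    exact (hα N' t ⟨ht.1, hlt.le⟩).mono_of_mem_nhdsWithin
      (mem_of_superset (Icc_mem_nhdsGE hlt) (Icc_subset_Icc_left ht.1))
  have hcontα : ∀ N N' : ℕ, N ≤ N' → ContinuousOn (α N') (Icc (0 : ℝ) N) :=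
    fun N N' hNN t ht => ((hα N' t ⟨ht.1, ht.2.trans (by exact_mod_cast hNN)⟩).continuousWithinAt).mono
      (Icc_subset_Icc_right (by exact_mod_cast hNN))
  have hagree : ∀ N N' : ℕ, N ≤ N' → EqOn (α N) (α N') (Icc (0 : ℝ) N) := fun N N' hNN =>
    ODE_solution_unique (v := fun _ => g) (fun _ => hg) (hcontα N N le_rfl) (hright N N le_rfl)
      (hcontα N N' hNN) (hright N N' hNN) (by rw [hα0, hα0])
  -- By uniqueness the local solutions agree, so the glued curve equals the single solution `α
  -- (⌈t₀⌉₊ + 2)` on `[0, t₀ + 1)`, a neighbourhood of `t₀` in `[0, ∞)`.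
  refine ⟨fun t => α (⌈t⌉₊ + 1) t, hα0 _, fun t₀ ht₀ => ?_⟩
  have ht₀' : (0 : ℝ) ≤ t₀ := ht₀
  set N := ⌈t₀⌉₊ + 2 with hN
  have hlt : t₀ < N := by
    have := Nat.le_ceil t₀
    push_cast [hN]; linarith
  have heq : ∀ t ∈ Ico (0 : ℝ) (t₀ + 1), α (⌈t⌉₊ + 1) t = α N t := by
    intro t ht
    refine hagree _ _ ?_ ⟨ht.1, ?_⟩
    · have : ⌈t⌉₊ ≤ ⌈t₀ + 1⌉₊ := Nat.ceil_mono ht.2.le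
      rw [Nat.ceil_add_one ht₀'] at this
      omega
    · have := Nat.le_ceil t
      push_cast; linarith
  have hd : HasDerivWithinAt (α N) (g (α N t₀)) (Ici 0) t₀ :=
    (hα N t₀ ⟨ht₀, hlt.le⟩).mono_of_mem_nhdsWithin
      (by
        filter_upwards [self_mem_nhdsWithin, nhdsWithin_le_nhds (Iio_mem_nhds hlt)] with t h1 h2
        exact ⟨h1, le_of_lt h2⟩)
  change HasDerivWithinAt _ (g (α (⌈t₀⌉₊ + 1) t₀)) _ _
  rw [heq t₀ ⟨ht₀, lt_add_one _⟩]
  refine hd.congr_of_eventuallyEq ?_ (heq t₀ ⟨ht₀, lt_add_one _⟩)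
  filter_upwards [self_mem_nhdsWithin, nhdsWithin_le_nhds (Iio_mem_nhds (lt_add_one t₀))]
    with t h1 h2 using heq t ⟨h1, h2⟩

namespace IsIntegralCurveOn

variable {E : Type*} [NormedAddCommGroup E] [NormedSpace ℝ E] {x : ℝ → E} {g : E → E}

theorem hasDerivWithinAt_Ici (hx : IsIntegralCurveOn x (fun _ => g) (Ici 0)) {t : ℝ}
    (ht : 0 ≤ t) : HasDerivWithinAt x (g (x t)) (Ici t) t :=
  (hx t ht).mono (Ici_subset_Ici.2 ht)

theorem continuousOn_Ici (hx : IsIntegralCurveOn x (fun _ => g) (Ici 0)) :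
    ContinuousOn x (Ici 0) := fun t ht => (hx t ht).continuousWithinAt

end IsIntegralCurveOn

namespace IsContractionMetric

variable {n : ℕ} {F : StateSpace n → StateSpace n}
  {P : StateSpace n → Matrix (Fin n) (Fin n) ℝ} {pLow pUp : ℝ → ℝ} {μ : ℝ}

/-- Multiplying `F` by a bump equal to 1 on the `R`-ball gives a bounded, globally Lipschitz field.
Its global solution never leaves that ball by `exists_exp_bound`, hence solves the original
equation. -/
theorem exists_isForwardSolution (h : IsContractionMetric F P pLow pUp μ) (e : StateSpace n) :
    ∃ x, IsForwardSolution F e x := by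
  obtain ⟨R, k, lam, hR, -, -, hb⟩ := h.exists_exp_bound (norm_nonneg e)
  let f : ContDiffBump (0 : StateSpace n) := ⟨R, R + 1, hR, lt_add_one R⟩
  have hgd : ContDiff ℝ 1 fun x => f x • F x := f.contDiff.smul h.contDiff_field
  have hgs : HasCompactSupport fun x => f x • F x := f.hasCompactSupport.smul_right
  obtain ⟨L, hL⟩ := hgs.exists_bound_of_continuous hgd.continuous
  obtain ⟨K, hK⟩ := hgd.lipschitzWith_of_hasCompactSupport hgs one_ne_zero
  obtain ⟨x, hx0, hx⟩ := hK.exists_isIntegralCurveOn_Ici (L := L.toNNReal)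
    (fun z => (hL z).trans (Real.le_coe_toNNReal L)) e
  have heq : ∀ z : StateSpace n, ‖z‖ ≤ R → f z • F z = F z := fun z hz => by
    rw [f.one_of_mem_closedBall (mem_closedBall_zero_iff.2 hz), one_smul]
  have hxR := hb x (fun t => f (x t) • F (x t)) (by rw [hx0]) hx.continuousOn_Ici
    (fun t ht => hx.hasDerivWithinAt_Ici ht) (fun t _ => heq _)
  refine ⟨x, hx0, fun t ht => ?_⟩
  have := hx t ht
  simp only [heq _ (hxR t ht).1] at this
  exact this

/-- Finiteness from below comes from the bounded slopes of `V` along the solution; the decay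
estimate gives the upper bound. -/
theorem exists_upperDini_eq (h : IsContractionMetric F P pLow pUp μ) {e : StateSpace n}
    {x : ℝ → StateSpace n} (hx : IsForwardSolution F e x) :
    ∃ d : ℝ, upperDini (fun z => riemannDist P z 0) x = (d : EReal) ∧
      d ≤ -(μ / (2 * pUp ‖e‖)) * riemannDist P e 0 := by
  obtain ⟨rfl, hx⟩ := hx
  have hd := hx.hasDerivWithinAt_Ici le_rfl
  have hslope : ∀ z, slope (fun s => riemannDist P (x s) 0) 0 z =
      (riemannDist P (x z) 0 - riemannDist P (x 0) 0) / z := fun z => by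
    rw [slope_def_field, sub_zero]
  have hle : ∀ r : ℝ, -(μ / (2 * pUp ‖x 0‖)) * riemannDist P (x 0) 0 < r →
      upperDini (fun z => riemannDist P z 0) x ≤ (r : EReal) := fun r hr => by
    refine limsup_le_of_le (h := ?_)
    filter_upwards [h.eventually_slope_lt hd hr] with z hz
    rw [hslope] at hz
    exact EReal.coe_le_coe_iff.2 hz.le
  obtain ⟨C, hC⟩ := h.exists_abs_slope_le hd
  have hge : ((-C : ℝ) : EReal) ≤ upperDini (fun z => riemannDist P z 0) x := by
    refine le_limsup_of_frequently_le (Eventually.frequently ?_)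
    filter_upwards [hC] with z hz
    rw [hslope] at hz
    exact EReal.coe_le_coe_iff.2 (abs_le.1 hz).1
  generalize upperDini (fun z => riemannDist P z 0) x = D at hle hge
  have hbot : D ≠ ⊥ := fun hb => by simp [hb] at hge
  have htop : D ≠ ⊤ := fun ht => by
    subst ht
    exact EReal.coe_ne_top _ (top_le_iff.1 (hle _ (lt_add_one _)))
  lift D to ℝ using ⟨htop, hbot⟩
  exact ⟨D, rfl, le_of_forall_gt_imp_ge_of_dense fun r hr => EReal.coe_le_coe_iff.1 (hle r hr)⟩

theorem locallyExpStable (h : IsContractionMetric F P pLow pUp μ)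
    {E : StateSpace n → ℝ → StateSpace n} (hE : ∀ e, IsForwardSolution F e (E e)) :
    LocallyExpStable E := by
  obtain ⟨R, k, lam, -, hk, hlam, hb⟩ := h.exists_exp_bound zero_le_one
  refine ⟨k, lam, 1, hk, hlam, one_pos, fun e he t ht => ?_⟩
  obtain ⟨h0, hx⟩ := hE e
  have := (hb (E e) (fun t => F (E e t)) (by rwa [h0]) hx.continuousOn_Ici
    (fun t ht => hx.hasDerivWithinAt_Ici ht) (fun _ _ _ => rfl) t ht).2
  rwa [h0] at this

theorem globallyAttractive (h : IsContractionMetric F P pLow pUp μ)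
    {E : StateSpace n → ℝ → StateSpace n} (hE : ∀ e, IsForwardSolution F e (E e)) :
    GloballyAttractive E := by
  intro e
  obtain ⟨R, k, lam, -, hk, hlam, hb⟩ := h.exists_exp_bound (norm_nonneg e)
  obtain ⟨h0, hx⟩ := hE e
  have hbound := hb (E e) (fun t => F (E e t)) (by rw [h0]) hx.continuousOn_Ici
    (fun t ht => hx.hasDerivWithinAt_Ici ht) (fun _ _ _ => rfl)
  have hlim : Tendsto (fun t => k * Real.exp (-lam * t) * ‖E e 0‖) atTop (𝓝 0) := by
    have h1 : Tendsto (fun t : ℝ => -lam * t) atTop atBot :=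
      tendsto_id.const_mul_atTop_of_neg (neg_lt_zero.2 hlam)
    simpa using ((Real.tendsto_exp_atBot.comp h1).const_mul k).mul_const ‖E e 0‖
  refine squeeze_zero' (Eventually.of_forall fun _ => norm_nonneg _) ?_ hlim
  filter_upwards [eventually_ge_atTop 0] with t ht using (hbound t ht).2

end IsContractionMetric

/-! ### From the matrix hypotheses to quadratic forms -/

section

variable {n : ℕ}

theorem quad_add (M N : Matrix (Fin n) (Fin n) ℝ) (v : StateSpace n) :
    quad (M + N) v = quad M v + quad N v := by
  simp [quad, Matrix.add_mulVec]

theorem quad_sub (M N : Matrix (Fin n) (Fin n) ℝ) (v : StateSpace n) :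
    quad (M - N) v = quad M v - quad N v := by
  simp [quad, Matrix.sub_mulVec]

theorem quad_neg (M : Matrix (Fin n) (Fin n) ℝ) (v : StateSpace n) :
    quad (-M) v = -quad M v := by
  simp [quad, Matrix.neg_mulVec]

theorem quad_eq_inner (M : Matrix (Fin n) (Fin n) ℝ) (v : StateSpace n) :
    quad M v = inner ℝ v (Matrix.toEuclideanLin M v) := by
  rw [quad, EuclideanSpace.inner_eq_star_dotProduct, dotProduct_comm]
  simp

theorem quad_smul_one (c : ℝ) (v : StateSpace n) :
    quad (c • (1 : Matrix (Fin n) (Fin n) ℝ)) v = c * ‖v‖ ^ 2 := by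
  rw [EuclideanSpace.real_norm_sq_eq]
  simp [quad, dotProduct, Matrix.smul_mulVec, Finset.mul_sum]
  exact Finset.sum_congr rfl fun i _ => by ring

theorem Matrix.PosSemidef.quad_nonneg {M : Matrix (Fin n) (Fin n) ℝ} (hM : M.PosSemidef)
    (v : StateSpace n) : 0 ≤ quad M v := by
  simpa using! hM.dotProduct_mulVec_nonneg v.ofLp

theorem jacobian_mulVec (F : StateSpace n → StateSpace n) (e v : StateSpace n) :
    jacobian F e *ᵥ v.ofLp = (fderiv ℝ F e v).ofLp := by
  ext i
  conv_rhs => rw [← (EuclideanSpace.basisFun (Fin n) ℝ).sum_repr v]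
  simp [jacobian, Matrix.mulVec, dotProduct, mul_comm]

/-- The flow derivative is tested on all local solutions through `e`, so it says something only once
one exists. Picard–Lindelöf supplies one, and the chain rule along it identifies the limit. -/
theorem HasDerivAlongFlow.apply_eq {F : StateSpace n → StateSpace n}
    {P : StateSpace n → Matrix (Fin n) (Fin n) ℝ} {e : StateSpace n}
    {D : Matrix (Fin n) (Fin n) ℝ} (h : HasDerivAlongFlow F P e D) (hF : ContDiffAt ℝ 1 F e)
    (i j : Fin n) (hP : DifferentiableAt ℝ (fun z => P z i j) e) :
    D i j = fderiv ℝ (fun z => P z i j) e (F e) := by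
  obtain ⟨x, hx0, ε, hε, hx⟩ :=
    hF.exists_forall_mem_closedBall_exists_eq_forall_mem_Ioo_hasDerivAt₀ 0
  have hcurve : IsIntegralCurveAt x (fun _ => F) 0 := by
    filter_upwards [Ioo_mem_nhds (by linarith : (0 : ℝ) - ε < 0) (by linarith : 0 < 0 + ε)]
      with t ht using hx t ht
  have hlim := ((continuous_apply_apply i j).tendsto D).comp (h x hx0 hcurve)
  have hder : HasDerivAt (fun t => P (x t) i j) (fderiv ℝ (fun z => P z i j) e (F e)) 0 := by
    have hfd : HasFDerivAt (fun z => P z i j) (fderiv ℝ (fun z => P z i j) e) (x 0) :=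
      hx0 ▸ hP.hasFDerivAt
    have := hcurve.hasDerivAt
    rw [hx0] at this
    exact hfd.comp_hasDerivAt 0 this
  refine tendsto_nhds_unique hlim ((hasDerivAt_iff_tendsto_slope.1 hder).congr fun t => ?_)
  simp only [slope, hx0, sub_zero, vsub_eq_sub, smul_eq_mul]
  rfl

theorem quadDeriv_eq_quad {F : StateSpace n → StateSpace n}
    {P : StateSpace n → Matrix (Fin n) (Fin n) ℝ} {e : StateSpace n}
    {D : Matrix (Fin n) (Fin n) ℝ} (hD : ∀ i j, D i j = fderiv ℝ (fun z => P z i j) e (F e))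
    (v : StateSpace n) :
    quadDeriv P e v (F e) (fderiv ℝ F e v) =
      quad (D + P e * jacobian F e + (jacobian F e)ᵀ * P e) v := by
  have h1 : quad (P e * jacobian F e) v = ∑ i, ∑ j, v i * P e i j * (fderiv ℝ F e v) j := by
    rw [quad, ← Matrix.mulVec_mulVec, jacobian_mulVec]
    simp [dotProduct, Matrix.mulVec, Finset.mul_sum, mul_assoc]
  have h2 : quad ((jacobian F e)ᵀ * P e) v =
      ∑ i, ∑ j, (fderiv ℝ F e v) i * P e i j * v j := by
    rw [quad, ← Matrix.mulVec_mulVec, Matrix.dotProduct_mulVec, Matrix.vecMul_transpose,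
      jacobian_mulVec]
    simp [dotProduct, Matrix.mulVec, Finset.mul_sum, mul_assoc]
  rw [quad_add, quad_add, h1, h2, quad_eq_sum]
  simp only [quadDeriv, ← Finset.sum_add_distrib, ← hD]
  exact Finset.sum_congr rfl fun i _ => Finset.sum_congr rfl fun j _ => by ring

/-- In an orthonormal eigenbasis the form is the sum of the squared coordinates weighted by the
eigenvalues. -/
theorem Matrix.IsHermitian.mul_norm_sq_le_quad {Q : Matrix (Fin n) (Fin n) ℝ}
    (hQ : Q.IsHermitian) {m : ℝ} (hm : ∀ i, m ≤ hQ.eigenvalues i) (v : StateSpace n) :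
    m * ‖v‖ ^ 2 ≤ quad Q v := by
  set b := hQ.eigenvectorBasis
  have hb : ∀ i, inner ℝ (b i) (Matrix.toEuclideanLin Q v) =
      hQ.eigenvalues i * inner ℝ (b i) v := by
    intro i
    have hsymm := Matrix.isSymmetric_toEuclideanLin_iff.2 hQ
    have hbi : Matrix.toEuclideanLin Q (b i) = hQ.eigenvalues i • b i := by
      ext k
      simpa using! congrFun (hQ.mulVec_eigenvectorBasis i) k
    rw [← hsymm (b i) v, hbi, real_inner_smul_left]
  rw [quad_eq_inner, ← b.sum_inner_mul_inner, ← real_inner_self_eq_norm_sq,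
    ← b.sum_inner_mul_inner, Finset.mul_sum]
  refine Finset.sum_le_sum fun i _ => ?_
  rw [hb, real_inner_comm]
  nlinarith [mul_le_mul_of_nonneg_right (hm i) (mul_self_nonneg (inner ℝ (b i) v))]

theorem Matrix.PosDef.minEigenvalue_pos_and_le_quad {Q : Matrix (Fin n) (Fin n) ℝ}
    (hQ : Q.PosDef) (hn : 0 < n) :
    0 < minEigenvalue Q ∧ ∀ v : StateSpace n, minEigenvalue Q * ‖v‖ ^ 2 ≤ quad Q v := by
  have hH := hQ.isHermitian
  obtain ⟨i, -, hi⟩ := Finset.exists_min_image Finset.univ hH.eigenvalues ⟨⟨0, hn⟩, Finset.mem_univ _⟩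
  have hquad := hH.mul_norm_sq_le_quad fun j => hi j (Finset.mem_univ j)
  have hleast : IsLeast {μ : ℝ | Module.End.HasEigenvalue (Matrix.toLin' Q) μ}
      (hH.eigenvalues i) := by
    constructor
    · refine Module.End.hasEigenvalue_of_hasEigenvector (x := (hH.eigenvectorBasis i).ofLp)
        ⟨Module.End.mem_eigenspace_iff.2 ?_, ?_⟩
      · rw [Matrix.toLin'_apply]; exact hH.mulVec_eigenvectorBasis i
      · intro h0
        exact hH.eigenvectorBasis.orthonormal.ne_zero i (by ext k; exact congrFun h0 k)
    · intro μ hμ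
      obtain ⟨w, hw⟩ := Module.End.HasEigenvalue.exists_hasEigenvector hμ
      have hw' := hw.apply_eq_smul
      rw [Matrix.toLin'_apply] at hw'
      have h1 := hquad (WithLp.toLp 2 w)
      have h2 : quad Q (WithLp.toLp 2 w) = μ * ‖WithLp.toLp 2 w‖ ^ 2 := by
        rw [quad, EuclideanSpace.real_norm_sq_eq, hw']
        simp [dotProduct, Finset.mul_sum]
        exact Finset.sum_congr rfl fun i _ => by ring
      rw [h2] at h1
      have h3 : 0 < ‖WithLp.toLp 2 w‖ := norm_pos_iff.2 fun h0 => hw.2 (by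
        simpa using h0)
      exact le_of_mul_le_mul_right h1 (by positivity)
  have hmin : minEigenvalue Q = hH.eigenvalues i := hleast.csInf_eq
  rw [hmin]
  exact ⟨hQ.eigenvalues_pos i, hquad⟩

/-- The conclusions for a contraction metric, with the rate `μ`. -/
theorem IsContractionMetric.riemannDist_isLyapunov {F : StateSpace n → StateSpace n}
    {P : StateSpace n → Matrix (Fin n) (Fin n) ℝ} {pLow pUp : ℝ → ℝ} {μ : ℝ}
    (h : IsContractionMetric F P pLow pUp μ) :
    Continuous (fun e => riemannDist P e 0) ∧
    riemannDist P 0 0 = 0 ∧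
    (∀ e, e ≠ 0 → 0 < riemannDist P e 0) ∧
    Tendsto (fun e => riemannDist P e 0) (Bornology.cobounded (StateSpace n)) atTop ∧
    (∀ e, √(pLow ‖e‖) * ‖e‖ ≤ riemannDist P e 0 ∧ riemannDist P e 0 ≤ √(pUp ‖e‖) * ‖e‖) ∧
    (∀ e, ∃ x, IsForwardSolution F e x) ∧
    (∀ E : StateSpace n → ℝ → StateSpace n, (∀ e, IsForwardSolution F e (E e)) →
      (∀ e, ∃ d : ℝ, upperDini (fun z => riemannDist P z 0) (E e) = (d : EReal) ∧
        d ≤ -(μ / (2 * pUp ‖e‖)) * riemannDist P e 0) ∧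
      LocallyExpStable E ∧ GloballyAttractive E) :=
  ⟨h.continuous_riemannDist, riemannDist_self 0, fun _ => h.riemannDist_pos,
    h.tendsto_riemannDist, fun e => ⟨h.le_riemannDist e, h.riemannDist_le_mul_norm e⟩,
    h.exists_isForwardSolution, fun _ hE => ⟨fun e => h.exists_upperDini_eq (hE e),
      h.locallyExpStable hE, h.globallyAttractive hE⟩⟩

end

end

/-! ### The theorem -/

theorem mainTheorem1 (n : ℕ)
    (F : StateSpace n → StateSpace n) (hF : ContDiff ℝ 2 F) (hF0 : F 0 = 0)
    (P : StateSpace n → Matrix (Fin n) (Fin n) ℝ)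
    (hPC2 : ∀ i j, ContDiff ℝ 2 (fun e => P e i j))
    (hPsymm : ∀ e, (P e).IsSymm)
    (pLow pUp : ℝ → ℝ)
    (hLowMono : AntitoneOn pLow (Ici 0)) (hUpMono : MonotoneOn pUp (Ici 0))
    (hLowPos : ∀ e : StateSpace n, 0 < pLow ‖e‖)
    (hLow : ∀ e, (P e - pLow ‖e‖ • (1 : Matrix (Fin n) (Fin n) ℝ)).PosSemidef)
    (hUp : ∀ e, (pUp ‖e‖ • (1 : Matrix (Fin n) (Fin n) ℝ) - P e).PosSemidef)
    (Q : Matrix (Fin n) (Fin n) ℝ) (hQ : Q.PosDef)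
    (hLie : ∀ e, ∃ D : Matrix (Fin n) (Fin n) ℝ, HasDerivAlongFlow F P e D ∧
      (-Q - (D + P e * jacobian F e + (jacobian F e)ᵀ * P e)).PosSemidef)
    (hproper : Tendsto (fun r : ℝ => pLow r * r ^ 2) atTop atTop) :
    -- `V = d_P(·, 0)` is continuous, positive definite and proper, with explicit bounds
    Continuous (fun e => riemannDist P e 0) ∧
    riemannDist P 0 0 = 0 ∧
    (∀ e, e ≠ 0 → 0 < riemannDist P e 0) ∧
    Tendsto (fun e => riemannDist P e 0) (Bornology.cobounded (StateSpace n)) atTop ∧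
    (∀ e, Real.sqrt (pLow ‖e‖) * ‖e‖ ≤ riemannDist P e 0 ∧
      riemannDist P e 0 ≤ Real.sqrt (pUp ‖e‖) * ‖e‖) ∧
    -- the system is forward complete
    (∀ e, ∃ x, IsForwardSolution F e x) ∧
    -- decrease of `V` along the solutions `E(e, t)`, and stability of the origin
    (∀ E : StateSpace n → ℝ → StateSpace n, (∀ e, IsForwardSolution F e (E e)) →
      (∀ e, ∃ d : ℝ, upperDini (fun z => riemannDist P z 0) (E e) = (d : EReal) ∧
        d ≤ -(minEigenvalue Q / (2 * pUp ‖e‖)) * riemannDist P e 0) ∧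
      LocallyExpStable E ∧ GloballyAttractive E) := by

  -- In dimension zero there are no eigenvalues and only the radius 0 is a norm, so `Q` gives no
  -- positive rate and the bounds say nothing at positive radii. Constant bounds and rate 1 are used
  -- instead, and the claims involving the given data reduce to `V = 0`.
  rcases Nat.eq_zero_or_pos n with rfl | hn
  · have h : IsContractionMetric F P (fun _ => 1) (fun _ => 1) 1 :=
      { continuous := fun i => i.elim0
        antitone := antitoneOn_const
        monotone := monotoneOn_const
        low_pos := fun _ _ => one_pos
        up_pos := fun _ _ => one_pos
        low := fun x v => by simp [quad, Subsingleton.elim v 0]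
        up := fun x v => by simp [quad]
        proper := by simp
        contDiff_metric := fun i => i.elim0
        contDiff_field := hF.of_le one_le_two
        field_zero := hF0
        rate_pos := one_pos
        contracts := fun x v => by simp [quadDeriv, Subsingleton.elim v 0] }
    have hzero : ∀ e : StateSpace 0, e = 0 := fun e => Subsingleton.elim e 0
    obtain ⟨h1, h2, h3, h4, -, h6, h7⟩ := h.riemannDist_isLyapunov
    refine ⟨h1, h2, h3, h4, fun e => by simp [hzero e, h2], h6, fun E hE => ⟨fun e => ?_, (h7 E hE).2⟩⟩
    obtain ⟨d, hd, hle⟩ := (h7 E hE).1 e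
    exact ⟨d, hd, hle.trans (by simp [hzero e, h2])⟩
  obtain ⟨hμ, hμQ⟩ := hQ.minEigenvalue_pos_and_le_quad hn
  -- For `n > 0` every `r ≥ 0` is a norm, which transfers positivity of the bounds from points to
  -- radii.
  have hnorm : ∀ r, 0 ≤ r → ∃ e : StateSpace n, ‖e‖ = r := fun r hr =>
    ⟨EuclideanSpace.single ⟨0, hn⟩ r, by simp [abs_of_nonneg hr]⟩
  have hlow : ∀ x v, pLow ‖x‖ * ‖v‖ ^ 2 ≤ quad (P x) v := fun x v => by
    have := (hLow x).quad_nonneg v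
    rw [quad_sub, quad_smul_one] at this
    linarith
  have hup : ∀ x v, quad (P x) v ≤ pUp ‖x‖ * ‖v‖ ^ 2 := fun x v => by
    have := (hUp x).quad_nonneg v
    rw [quad_sub, quad_smul_one] at this
    linarith
  have hlowpos : ∀ r, 0 ≤ r → 0 < pLow r := fun r hr => by
    obtain ⟨e, rfl⟩ := hnorm r hr
    exact hLowPos e
  have huppos : ∀ r, 0 ≤ r → 0 < pUp r := fun r hr => by
    obtain ⟨e, rfl⟩ := hnorm r hr
    obtain ⟨v, hv⟩ := hnorm 1 zero_le_one
    have := (hlow e v).trans (hup e v)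
    rw [hv] at this
    linarith [hLowPos e]
  have hP1 : ∀ i j, ContDiff ℝ 1 fun e => P e i j := fun i j => (hPC2 i j).of_le one_le_two
  have hF1 : ContDiff ℝ 1 F := hF.of_le one_le_two
  refine IsContractionMetric.riemannDist_isLyapunov (μ := minEigenvalue Q)
    { continuous := fun i j => (hPC2 i j).continuous
      antitone := hLowMono
      monotone := hUpMono
      low_pos := hlowpos
      up_pos := huppos
      low := hlow
      up := hup
      proper := hproper
      contDiff_metric := hP1
      contDiff_field := hF1
      field_zero := hF0
      rate_pos := hμ
      contracts := fun x v => ?_ }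
  obtain ⟨D, hD, hneg⟩ := hLie x
  rw [quadDeriv_eq_quad (fun i j => hD.apply_eq hF1.contDiffAt i j
    ((hP1 i j).differentiable one_ne_zero x)) v]
  have := hneg.quad_nonneg v
  rw [quad_sub, quad_neg] at this
  linarith [hμQ v]
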